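/- A \emph{Fréchet space} is a locally convex topological vector space over $\mathbb{R}$ endowed with a complete translation-invariant metric that generates its topology. A topological space $X$ has the \emph{locally finite approximation property} (LFAP) if for every open cover $\mathcal{U}$ of $X$ there is a sequence of continuous maps $f_n : X \to X$, $n = 0, 1, 2, \dots$, such that each $f_n$ is $\mathcal{U}$-near to the identity map of $X$ (that is, for every $x \in X$ there is $U \in \mathcal{U}$ with $x \in U$ and $f_n(x) \in U$), and the indexed family $(f_n(X))_{n}$ is locally finite in $X$ (that is, every point of $X$ has a neighborhood in $X$ that meets $f_n(X)$ for only finitely many indices $n$). \textbf{Theorem.} Every non-separable convex subset of a Fréchet space (with the subspace topology) has the locally finite approximation property. -/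

import Mathlib

/-- Two functions `f, g : Y → X` are `𝒰`-near, for a family `𝒰` of subsets of `X`, if for every
point `y` some member of `𝒰` contains both `f y` and `g y`. -/
def CoverNear {Y X : Type*} (𝒰 : Set (Set X)) (f g : Y → X) : Prop :=
  ∀ y : Y, ∃ U ∈ 𝒰, f y ∈ U ∧ g y ∈ U

/-- The locally finite approximation property (LFAP) of a topological space `X`: for every open
cover `𝒰` of `X` there is a sequence of continuous maps `f n : X → X`, each `𝒰`-near to the
identity, such that the indexed family `(f n (X))` is locally finite in `X`. -/
def LFAP (X : Type*) [TopologicalSpace X] : Prop :=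
  ∀ 𝒰 : Set (Set X), (∀ U ∈ 𝒰, IsOpen U) → ⋃₀ 𝒰 = Set.univ →
    ∃ f : ℕ → X → X, (∀ n, Continuous (f n)) ∧ (∀ n, CoverNear 𝒰 (f n) id) ∧
      LocallyFinite (fun n => Set.range (f n))

/-!
Let `X` be a non-separable convex set. A countability argument yields a point `x₀`, a *bounded*
sequence `b` with `x₀ + b k ∈ X`, and an equicontinuous sequence of functionals `g` that is
triangular on it: `g k (b j) = 0` for `j < k` and `g k (b k) = 1`
(`exists_bounded_seq_far_from_span`, `exists_dual_vanishing_eq_one`). Together the functionals form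
a continuous linear map `g` from the ambient space to `ℓ^∞` that maps each `b j` into `c₀`.

If `g` mapped everything into `c₀`, one could argue as follows: given `x` and `n`, choose `k ≥ n` so
large that the coordinates of `g x` from `k` on are negligible, and push `x` slightly towards
`x₀ + b k`. The image has a coordinate beyond `n` that is bounded below. Near a fixed point the
coordinates of `g` tend to zero uniformly, so such images leave every small neighborhood as `n`
grows.

In general `g x` is only bounded, and it may be impossible to find functionals that tend to zero
pointwise on a non-separable space. But `c₀` need not be reached linearly: by the Bartle–Graves theorem the
quotient map `ℓ^∞ → ℓ^∞ / c₀` has a continuous section, hence there is a continuous map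
`r : ℓ^∞ → c₀` with `r (u + c) = r u + c` for `c ∈ c₀`
(`exists_equivariant_map_nullSequences`). The map `G = r ∘ g` takes values in `c₀` and still responds
to displacements in the directions `b k` exactly as `g` does, which is all the argument needs
(`lfap_of_bounded_triangular`).

To make the choice of `k` continuous in `x`, the points `b k` are joined by a polygonal line. On the
edge from `b k` to `b (k + 1)` either the coordinate `k + 1` or the coordinate `k` is bounded below,
by triangularity.
-/

open Filter Topology Set
open scoped Pointwise

/-! ### Continuous sections of quotient maps and equivariant maps onto `c₀` -/

section Lifting

variable {V : Type*} [NormedAddCommGroup V] [NormedSpace ℝ V]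

/-- Approximate lifting through a quotient map with norm control: the lifts of `u z` of norm
less than `r z`, up to an error `ε`, form convex sets, and a constant selection works locally. -/
theorem exists_continuous_approx_lift (C : Submodule ℝ V) [IsClosed (C : Set V)]
    (u : C(V ⧸ C, V ⧸ C)) (r : C(V ⧸ C, ℝ)) (hu : ∀ z, ‖u z‖ < r z)
    {ε : ℝ} (hε : 0 < ε) :
    ∃ v : C(V ⧸ C, V), ∀ z, ‖v z‖ < r z ∧ ‖u z - C.mkQ (v z)‖ < ε := by
  refine exists_continuous_forall_mem_convex_of_local_const
    (t := fun z => {v : V | ‖v‖ < r z ∧ ‖u z - C.mkQ v‖ < ε}) (fun z => ?_) fun z => ?_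
  · have h1 : Convex ℝ {v : V | ‖v‖ < r z} := by
      simpa [Metric.ball, dist_zero_right] using convex_ball (0 : V) (r z)
    have h2 : Convex ℝ {v : V | ‖u z - C.mkQ v‖ < ε} := by
      convert (convex_ball (u z) ε).linear_preimage C.mkQ using 1
      ext v
      simp [dist_eq_norm, norm_sub_rev]
    exact h1.inter h2
  · obtain ⟨v, hv, hvr⟩ := Submodule.Quotient.norm_mk_lt (u z) (sub_pos.2 (hu z))
    rw [add_sub_cancel] at hvr
    refine ⟨v, ((continuous_const.tendsto z).eventually_lt (r.continuous.tendsto z) hvr).and ?_⟩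
    have : Continuous fun y => ‖u y - C.mkQ v‖ := by fun_prop
    refine (this.tendsto z).eventually_lt_const ?_
    simpa [hv] using hε

/-- The Bartle–Graves theorem for a quotient of a Banach space: the quotient map has a continuous,
in general nonlinear, section. It is the sum of a series of approximate lifts, each of which lifts
the error left by the preceding ones. -/
theorem exists_continuous_section_mkQ [CompleteSpace V] (C : Submodule ℝ V)
    [IsClosed (C : Set V)] :
    ∃ s : V ⧸ C → V, Continuous s ∧ ∀ z, C.mkQ (s z) = z := by
  have hq : Continuous C.mkQ := C.mkQL.continuous
  obtain ⟨v₀, hv₀⟩ := exists_continuous_approx_lift C (ContinuousMap.id _)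
    ⟨fun z => ‖z‖ + 1, by fun_prop⟩ (fun z => by simp) one_pos
  have step (n : ℕ) (u : C(V ⧸ C, V ⧸ C)) : ∃ v : C(V ⧸ C, V),
      (∀ z, ‖u z‖ < (1 / 2) ^ n) →
        ∀ z, ‖v z‖ < (1 / 2) ^ n ∧ ‖u z - C.mkQ (v z)‖ < (1 / 2) ^ (n + 1) := by
    by_cases hu : ∀ z, ‖u z‖ < (1 / 2) ^ n
    · obtain ⟨v, hv⟩ := exists_continuous_approx_lift C u
        (ContinuousMap.const _ ((1 / 2) ^ n)) hu (ε := (1 / 2) ^ (n + 1)) (by positivity)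
      exact ⟨v, fun _ => hv⟩
    · exact ⟨0, fun h => absurd h hu⟩
  choose v hv using step
  let u : ℕ → C(V ⧸ C, V ⧸ C) := fun n => Nat.rec
    (ContinuousMap.id _ - (⟨C.mkQ, hq⟩ : C(V, V ⧸ C)).comp v₀)
    (fun n w => w - (⟨C.mkQ, hq⟩ : C(V, V ⧸ C)).comp (v n w)) n
  have hu (n : ℕ) : ∀ z, ‖u n z‖ < (1 / 2) ^ n := by
    induction n with
    | zero => exact fun z => by rw [pow_zero]; exact (hv₀ z).2
    | succ n ih => exact fun z => (hv n (u n) ih z).2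
  have hsum : Summable fun n : ℕ => ((1 : ℝ) / 2) ^ n := summable_geometric_two
  have hbound (n : ℕ) (z : V ⧸ C) : ‖v n (u n) z‖ ≤ (1 / 2) ^ n := (hv n (u n) (hu n) z).1.le
  refine ⟨fun z => v₀ z + ∑' n, v n (u n) z, v₀.continuous.add
    (continuous_tsum (fun n => (v n (u n)).continuous) hsum hbound), fun z => ?_⟩
  -- The partial sums lift `z` up to the error `u n z`, which tends to zero.
  have hpart (n : ℕ) :
      C.mkQ (v₀ z + ∑ i ∈ Finset.range n, v i (u i) z) = z - u n z := by
    induction n with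
    | zero => simp [u]
    | succ n ih =>
      have : u (n + 1) z = u n z - C.mkQ (v n (u n) z) := rfl
      rw [Finset.sum_range_succ, ← add_assoc, map_add, ih, this]
      abel
  have hlim : Tendsto (fun n => C.mkQ (v₀ z + ∑ i ∈ Finset.range n, v i (u i) z)) atTop
      (𝓝 (C.mkQ (v₀ z + ∑' n, v n (u n) z))) :=
    (hq.tendsto _).comp (tendsto_const_nhds.add
      ((hsum.of_norm_bounded fun n => hbound n z).hasSum.tendsto_sum_nat))
  have hzero : Tendsto (fun n => u n z) atTop (𝓝 0) :=
    squeeze_zero_norm (fun n => (hu n z).le)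
      (tendsto_pow_atTop_nhds_zero_of_lt_one (by norm_num) (by norm_num))
  have hlim' : Tendsto (fun n => z - u n z) atTop (𝓝 z) := by
    simpa using tendsto_const_nhds.sub hzero
  exact tendsto_nhds_unique hlim (by simpa only [hpart] using hlim')

open BoundedContinuousFunction in
/-- The space `c₀` of real sequences tending to zero, as a subspace of the space `ℓ^∞` of bounded
sequences. The latter is encoded as the space of bounded continuous functions on the discrete
space `ℕ`. -/
def nullSequences : Submodule ℝ (ℕ →ᵇ ℝ) where
  carrier := {c | Tendsto c atTop (𝓝 0)}
  add_mem' {a b} (ha : Tendsto a _ _) (hb : Tendsto b _ _) := by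
    show Tendsto (fun n => a n + b n) _ _
    simpa only [add_zero] using ha.add hb
  zero_mem' := tendsto_const_nhds
  smul_mem' t a (ha : Tendsto a _ _) := by
    show Tendsto (fun n => t * a n) _ _
    simpa only [mul_zero] using ha.const_mul t

theorem isClosed_nullSequences :
    IsClosed (nullSequences : Set (BoundedContinuousFunction ℕ ℝ)) := by
  refine isClosed_of_closure_subset fun c hc => ?_
  refine Metric.tendsto_atTop.2 fun ε hε => ?_
  obtain ⟨d, hd, hcd⟩ := Metric.mem_closure_iff.1 hc (ε / 2) (half_pos hε)
  obtain ⟨N, hN⟩ := Metric.tendsto_atTop.1 (show Tendsto d atTop (𝓝 0) from hd) (ε / 2)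
    (half_pos hε)
  refine ⟨N, fun n hn => ?_⟩
  calc dist (c n) 0 ≤ dist (c n) (d n) + dist (d n) 0 := dist_triangle _ _ _
    _ < ε / 2 + ε / 2 :=
      add_lt_add_of_le_of_lt ((BoundedContinuousFunction.dist_coe_le_dist n).trans hcd.le) (hN n hn)
    _ = ε := add_halves ε

open BoundedContinuousFunction in
/-- There is a continuous map from `ℓ^∞` to `c₀` that commutes with translations by elements of
`c₀`: subtract from a sequence the value of a continuous section of `ℓ^∞ → ℓ^∞ / c₀`. A bounded
*linear* map of this kind would be a projection onto `c₀`, which does not exist. -/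
theorem exists_equivariant_map_nullSequences :
    ∃ r : (ℕ →ᵇ ℝ) → (ℕ →ᵇ ℝ), Continuous r ∧ (∀ u, r u ∈ nullSequences) ∧
      ∀ u, ∀ c ∈ nullSequences, r (u + c) = r u + c := by
  have := isClosed_nullSequences
  obtain ⟨s, hs, hsq⟩ := exists_continuous_section_mkQ nullSequences
  refine ⟨fun u => u - s (nullSequences.mkQ u),
    continuous_id.sub (hs.comp nullSequences.mkQL.continuous), fun u => ?_, fun u c hc => ?_⟩
  · refine (Submodule.Quotient.mk_eq_zero nullSequences).1 ?_
    rw [← Submodule.mkQ_apply, map_sub, hsq, sub_self]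
  · have : nullSequences.mkQ c = 0 := by simpa using hc
    simp only [map_add, this, add_zero]
    abel

end Lifting

/-! ### Bounded triangular sequences in non-separable sets -/

section Selection

variable {E : Type*} [AddCommGroup E]

/-- The set `S` lies in the union of countably many translates `d + U` of the set `U`. The sets `S`
with this property form a σ-ideal; the translates need not be centred at points of `S`. -/
def CountablyCovered (U S : Set E) : Prop :=
  ∃ D : Set E, D.Countable ∧ ∀ x ∈ S, ∃ d ∈ D, x - d ∈ U

theorem CountablyCovered.mono {U S T : Set E} (h : CountablyCovered U T) (hST : S ⊆ T) :
    CountablyCovered U S :=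
  let ⟨D, hD, hT⟩ := h
  ⟨D, hD, fun x hx => hT x (hST hx)⟩

theorem CountablyCovered.iUnion {U : Set E} {S : ℕ → Set E}
    (h : ∀ n, CountablyCovered U (S n)) : CountablyCovered U (⋃ n, S n) := by
  choose D hD hS using h
  refine ⟨⋃ n, D n, countable_iUnion hD, fun x hx => ?_⟩
  obtain ⟨n, hn⟩ := mem_iUnion.1 hx
  obtain ⟨d, hd, hxd⟩ := hS n x hn
  exact ⟨d, mem_iUnion.2 ⟨n, hd⟩, hxd⟩

theorem exists_not_countablyCovered_of_not_separableSpace {E : Type*} [AddCommGroup E]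
    [PseudoMetricSpace E] (hinv : ∀ x y z : E, dist (x + z) (y + z) = dist x y) {X : Set E}
    (hX : ¬ TopologicalSpace.SeparableSpace X) :
    ∃ U ∈ 𝓝 (0 : E), ¬ CountablyCovered U X := by
  by_contra! h
  refine hX (TopologicalSpace.IsSeparable.separableSpace ?_)
  obtain ⟨t, -, ht, hXt⟩ := UniformSpace.subset_countable_closure_of_almost_dense_set X
    fun R hR => by
      obtain ⟨ε, hε, hεR⟩ := Metric.mem_uniformity_dist.1 hR
      obtain ⟨D, hD, hXD⟩ := h _ (Metric.ball_mem_nhds 0 hε)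
      refine ⟨D, hD, fun x hx => ?_⟩
      obtain ⟨d, hd, hxd⟩ := hXD x hx
      rw [Metric.mem_ball', ← hinv _ _ d, sub_add_cancel, zero_add] at hxd
      exact mem_biUnion hd (hεR hxd)
  exact ⟨t, ht, hXt⟩

variable [Module ℝ E] [TopologicalSpace E] [IsTopologicalAddGroup E] [ContinuousSMul ℝ E]

theorem countablyCovered_near_span {U W : Set E} (hW : W ∈ 𝓝 0)
    (hWU : ∀ v ∈ W, ∀ w ∈ W, v + w ∈ U) (F : Finset E) :
    CountablyCovered U {x | ∃ v ∈ Submodule.span ℝ (F : Set E), x - v ∈ W} := by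
  obtain ⟨D, hD, hFD⟩ := (F.finite_toSet.isSeparable).span (R := ℝ)
  refine ⟨D, hD, fun x ⟨v, hv, hxv⟩ => ?_⟩
  have : ∀ᶠ d in 𝓝 v, v - d ∈ W := by
    have hc : Continuous fun d => v - d := by fun_prop
    exact hc.continuousAt.eventually_mem (by simpa using hW)
  obtain ⟨d, hdW, hd⟩ := mem_closure_iff_nhds.1 (hFD hv) _ this
  exact ⟨d, hd, by simpa using hWU _ hxv _ hdW⟩

omit [IsTopologicalAddGroup E] in
/-- A set that is not countably covered has a subset with the same property that is absorbed by a
given neighborhood of zero, because it is a countable union of such subsets. -/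
theorem exists_not_countablyCovered_bounded {U S V : Set E} (hS : ¬ CountablyCovered U S)
    (hV : V ∈ 𝓝 0) :
    ∃ T ⊆ S, ¬ CountablyCovered U T ∧ ∃ t : ℝ, 0 < t ∧ ∀ x ∈ T, t • x ∈ V := by
  by_contra! h
  have hcov : ∀ n : ℕ, CountablyCovered U {x ∈ S | ((1 : ℝ) / (n + 1)) • x ∈ V} := fun n => by
    by_contra hn
    obtain ⟨x, hx, hxV⟩ := h _ (sep_subset _ _) hn (1 / (n + 1)) (by positivity)
    exact hxV hx.2
  refine hS ((CountablyCovered.iUnion hcov).mono fun x hx => ?_)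
  have hlim : Tendsto (fun n : ℕ => ((1 : ℝ) / (n + 1)) • x) atTop (𝓝 0) := by
    simpa using (tendsto_one_div_add_atTop_nhds_zero_nat (𝕜 := ℝ)).smul_const x
  obtain ⟨n, hn⟩ := (hlim.eventually_mem hV).exists
  exact mem_iUnion.2 ⟨n, hx, hn⟩

/-- From a set that is not countably covered one can extract a bounded sequence whose terms stay
away from the linear span of the preceding ones. Boundedness comes from a diagonal argument: the
`k`-th term lies in a subset that is absorbed by the first `k` members of a countable neighborhood
basis. Such a subset is never contained in the `W`-neighborhood of a finitely generated subspace,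
as the latter is countably covered. A separable set need not contain such a sequence: bounded
subsets of `ℝ^ℕ` are precompact. -/
theorem exists_bounded_seq_far_from_span [FirstCountableTopology E] {U W S : Set E}
    (hS : ¬ CountablyCovered U S) (hW : W ∈ 𝓝 0) (hWU : ∀ v ∈ W, ∀ w ∈ W, v + w ∈ U) :
    ∃ b : ℕ → E, (∀ k, b k ∈ S) ∧ (∀ O ∈ 𝓝 (0 : E), ∀ᶠ s : ℝ in 𝓝 0, ∀ k, s • b k ∈ O) ∧
      ∀ k, ∀ v ∈ Submodule.span ℝ (b '' Iio k), b k - v ∉ W := by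
  classical
  obtain ⟨V, hVb, hV⟩ := (nhds_basis_balanced ℝ E).exists_antitone_subbasis
  have step (n : ℕ) (T : {T : Set E // ¬ CountablyCovered U T}) :
      ∃ T' : {T : Set E // ¬ CountablyCovered U T}, T'.1 ⊆ T.1 ∧
        ∃ t : ℝ, 0 < t ∧ ∀ x ∈ T'.1, t • x ∈ V n := by
    obtain ⟨T', hT'T, hT', ht⟩ := exists_not_countablyCovered_bounded T.2 (hVb n).1
    exact ⟨⟨T', hT'⟩, hT'T, ht⟩
  choose next hnext t ht htV using step
  let T : ℕ → {T : Set E // ¬ CountablyCovered U T} := fun n => Nat.rec ⟨S, hS⟩ next n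
  have hT : Antitone fun n => (T n).1 := antitone_nat_of_succ_le fun n => hnext n (T n)
  have pick (k : ℕ) (F : Finset E) :
      ∃ x ∈ (T k).1, ∀ v ∈ Submodule.span ℝ (F : Set E), x - v ∉ W := by
    by_contra! h
    exact (T k).2 ((countablyCovered_near_span hW hWU F).mono h)
  choose p hpT hpW using pick
  let F : ℕ → Finset E := fun k => Nat.rec ∅ (fun k F => insert (p k F) F) k
  have hF (k : ℕ) : F (k + 1) = insert (p k (F k)) (F k) := rfl
  have hFmono : Monotone F := monotone_nat_of_le_succ fun k => by
    rw [hF]; exact Finset.subset_insert _ _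
  refine ⟨fun k => p k (F k), fun k => hT k.zero_le (hpT k _), fun O hO => ?_, fun k v hv =>
    hpW k _ v (Submodule.span_mono ?_ hv)⟩
  · obtain ⟨n, hn⟩ := hV.mem_iff.1 hO
    -- The terms from the index `n + 1` on are absorbed by `V n`; the others are finitely many.
    have hinit : ∀ k ∈ Finset.range (n + 1), ∀ᶠ s : ℝ in 𝓝 0, s • p k (F k) ∈ O := fun k _ => by
      have hc : Continuous fun s : ℝ => s • p k (F k) := by fun_prop
      exact hc.continuousAt.eventually_mem (by simpa using hO)
    have hsmall : ∀ᶠ s : ℝ in 𝓝 0, |s| < t n (T n) :=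
      continuous_abs.continuousAt.eventually_lt_const (by simpa using ht n (T n))
    filter_upwards [(Finset.eventually_all _).2 hinit, hsmall] with s hs hst k
    by_cases hk : k < n + 1
    · exact hs k (Finset.mem_range.2 hk)
    · have hmem : t n (T n) • p k (F k) ∈ V n :=
        htV n (T n) _ (hT (not_lt.1 hk) (hpT k _))
      have hne := (ht n (T n)).ne'
      have := (hVb n).2.smul_mem (a := s / t n (T n)) (by
        rw [norm_div, Real.norm_eq_abs, Real.norm_eq_abs, abs_of_pos (ht n (T n))]
        exact div_le_one_of_le₀ hst.le (ht n (T n)).le) hmem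
      rw [smul_smul, div_mul_cancel₀ _ hne] at this
      exact hn this
  · rintro _ ⟨j, hj, rfl⟩
    exact hFmono (Nat.succ_le_of_lt hj) (by simp [hF])

theorem exists_dual_vanishing_eq_one {W : Set E} (hWc : Convex ℝ W) (hWo : IsOpen W)
    (hW0 : (0 : E) ∈ W) (hWs : ∀ w ∈ W, -w ∈ W) (F : Submodule ℝ E) {x : E}
    (hx : ∀ v ∈ F, x - v ∉ W) :
    ∃ g : StrongDual ℝ E, (∀ v ∈ F, g v = 0) ∧ g x = 1 ∧ ∀ w ∈ W, |g w| ≤ 1 := by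
  obtain ⟨f, hf⟩ := geometric_hahn_banach_open_point (s := (F : Set E) + W) (x := x)
    (F.convex.add hWc) hWo.add_left (by
      rintro ⟨v, hv, w, hw, rfl⟩
      exact hx v hv (by simpa using hw))
  have hfF : ∀ v ∈ F, f v < f x := fun v hv => hf v ⟨v, hv, 0, hW0, add_zero v⟩
  have hfW : ∀ w ∈ W, f w < f x := fun w hw => hf w ⟨0, F.zero_mem, w, hw, zero_add w⟩
  have hfx : 0 < f x := by simpa using hfF 0 F.zero_mem
  have hzero : ∀ v ∈ F, f v = 0 := fun v hv => by
    by_contra hne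
    have := hfF ((f x / f v) • v) (F.smul_mem _ hv)
    rw [map_smul, smul_eq_mul, div_mul_cancel₀ _ hne] at this
    exact this.false
  refine ⟨(f x)⁻¹ • f, fun v hv => by simp [hzero v hv], by simp [hfx.ne'], fun w hw => ?_⟩
  rw [smul_apply, smul_eq_mul, ← div_eq_inv_mul, abs_div, abs_of_pos hfx]
  refine div_le_one_of_le₀ (abs_le.2 ⟨?_, (hfW w hw).le⟩) hfx.le
  have := hfW _ (hWs w hw)
  rw [map_neg] at this
  linarith

end Selection

/-! ### Maps with a locally finite family of images -/

section Construction

variable {E : Type*} [AddCommGroup E] [Module ℝ E] [TopologicalSpace E]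

/-- The infinite polygonal line with vertices `b 0, b 1, …`, parametrized so that the vertex `b k`
is reached at time `k`. -/
theorem exists_piecewise_affine [ContinuousAdd E] [ContinuousSMul ℝ E] (b : ℕ → E) :
    ∃ β : ℝ → E, Continuous β ∧ ∀ θ, 0 ≤ θ → ∃ u ∈ Icc (0 : ℝ) 1,
      β θ = (1 - u) • b ⌊θ⌋₊ + u • b (⌊θ⌋₊ + 1) := by
  refine ⟨fun θ => ∑ᶠ k : ℕ, max 0 (1 - |θ - k|) • b k,
    continuous_finsum (fun k => by fun_prop) fun θ => ?_, fun θ hθ => ?_⟩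
  · refine ⟨Metric.ball θ 1, Metric.ball_mem_nhds θ one_pos,
      (finite_Iic ⌊|θ| + 2⌋₊).subset fun k ⟨z, hz, hzθ⟩ => Nat.le_floor ?_⟩
    rw [Metric.mem_ball, Real.dist_eq] at hzθ
    have hzk : |z - k| < 1 := by
      by_contra! h
      exact hz (by simp [max_eq_left (sub_nonpos.2 h)])
    linarith [abs_lt.1 hzθ, abs_lt.1 hzk, le_abs_self θ]
  · have h0 := Nat.floor_le hθ
    have h1 := Nat.lt_floor_add_one θ
    refine ⟨θ - ⌊θ⌋₊, ⟨by linarith, by linarith⟩, ?_⟩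
    dsimp only
    rw [finsum_eq_sum_of_support_subset (s := {⌊θ⌋₊, ⌊θ⌋₊ + 1}) _ ?_,
      Finset.sum_pair (Nat.succ_ne_self _).symm]
    · push_cast
      rw [abs_of_nonneg (by linarith), abs_of_nonpos (by linarith), max_eq_right (by linarith),
        max_eq_right (by linarith)]
      congr 2
      ring
    · intro k hk
      have hθk : |θ - k| < 1 := by
        by_contra! h
        exact hk (by simp [max_eq_left (sub_nonpos.2 h)])
      have h2 := abs_lt.1 hθk
      have h3 : (k : ℝ) < (⌊θ⌋₊ + 2 : ℕ) := by push_cast; linarith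
      have h4 : ((⌊θ⌋₊ : ℕ) : ℝ) < (k + 1 : ℕ) := by push_cast; linarith
      have h5 := Nat.cast_lt.1 h3
      have h6 := Nat.cast_lt.1 h4
      simp only [Finset.coe_insert, Finset.coe_singleton, mem_insert_iff, mem_singleton_iff]
      omega

open BoundedContinuousFunction in
/-- An equicontinuous sequence of functionals is the same as a continuous linear map to `ℓ^∞`. -/
theorem exists_continuous_linearMap_bounded [IsTopologicalAddGroup E] [ContinuousSMul ℝ E]
    {W : Set E} (hW : W ∈ 𝓝 0) (g : ℕ → StrongDual ℝ E) (hg : ∀ k, ∀ w ∈ W, |g k w| ≤ 1) :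
    ∃ Γ : E →ₗ[ℝ] (ℕ →ᵇ ℝ), Continuous Γ ∧ ∀ x k, Γ x k = g k x := by
  have hscale {t : ℝ} (ht : 0 < t) {x : E} (hx : t • x ∈ W) (k : ℕ) : |g k x| ≤ 1 / t := by
    have := hg k _ hx
    rw [map_smul, smul_eq_mul, abs_mul, abs_of_pos ht] at this
    rwa [le_div_iff₀ ht, mul_comm]
  have habs (x : E) : ∃ t : ℝ, 0 < t ∧ t • x ∈ W := by
    have hc : Continuous fun t : ℝ => t • x := by fun_prop
    have h : ∀ᶠ t in 𝓝 (0 : ℝ), t • x ∈ W := hc.continuousAt.eventually_mem (by simpa using hW)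
    obtain ⟨t, ht, htx⟩ := ((h.filter_mono nhdsWithin_le_nhds).and
      (self_mem_nhdsWithin : Ioi (0 : ℝ) ∈ 𝓝[>] 0)).exists
    exact ⟨t, htx, ht⟩
  choose t ht htW using habs
  let Γ : E →ₗ[ℝ] (ℕ →ᵇ ℝ) :=
    { toFun := fun x => ofNormedAddCommGroupDiscrete (fun k => g k x) (1 / t x)
        fun k => hscale (ht x) (htW x) k
      map_add' := fun x y => by ext k; exact map_add (g k) x y
      map_smul' := fun c x => by ext k; exact map_smul (g k) c x }
  refine ⟨Γ, ?_, fun _ _ => rfl⟩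
  refine continuous_of_continuousAt_zero Γ ?_
  rw [ContinuousAt, map_zero, Metric.tendsto_nhds]
  intro ε hε
  have hc : Continuous fun x : E => (2 / ε) • x := by fun_prop
  filter_upwards [hc.continuousAt.eventually_mem (x := 0) (by simpa using hW)] with x hx
  rw [dist_zero_right]
  refine lt_of_le_of_lt ((norm_le (by positivity)).2 fun k => ?_) (half_lt_self hε)
  rw [Real.norm_eq_abs, ← one_div_div]
  exact hscale (by positivity) hx k

/-- Boundedness of a set `B` used as continuity: small multiples of points of `B` may be treated as
arguments tending to zero, uniformly over `B`. -/
theorem eventually_forall_mem_of_bounded {B : Set E}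
    (hB : ∀ O ∈ 𝓝 (0 : E), ∀ᶠ s : ℝ in 𝓝 0, ∀ v ∈ B, s • v ∈ O) {Z : Type*}
    [TopologicalSpace Z] {Φ : Z × ℝ × E → E} {z : Z} (hΦ : ContinuousAt Φ (z, 0, 0)) {O : Set E}
    (hO : O ∈ 𝓝 (Φ (z, 0, 0))) :
    ∃ A ∈ 𝓝 z, ∃ δ > 0, ∀ x ∈ A, ∀ s : ℝ, |s| < δ → ∀ v ∈ B, Φ (x, s, s • v) ∈ O := by
  have h := hΦ.eventually_mem hO
  rw [nhds_prod_eq, nhds_prod_eq] at h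
  obtain ⟨A, hA, P, hP, h⟩ := eventually_prod_iff.1 h
  obtain ⟨P₁, hP₁, P₂, hP₂, hP'⟩ := eventually_prod_iff.1 hP
  obtain ⟨δ, hδ, hδP⟩ := Metric.eventually_nhds_iff.1 (hP₁.and (hB _ hP₂))
  refine ⟨_, hA, δ, hδ, fun x hx s hs v hv => ?_⟩
  obtain ⟨h₁, h₂⟩ := hδP (by rwa [Real.dist_eq, sub_zero] : dist s 0 < δ)
  exact h hx (hP' h₁ (h₂ v hv))

/-- For an open cover of `X` and a bounded set `B` there is a continuous positive function `η` on
`X` such that moving `x` towards points `x₀ + v`, `v ∈ B`, by the proportion `η x` at most keeps it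
in a member of the cover that contains `x`. -/
theorem exists_continuous_displacement {E : Type*} [AddCommGroup E] [Module ℝ E] [MetricSpace E]
    [ContinuousAdd E] [ContinuousSMul ℝ E] {X : Set E} (x₀ : E) {B : Set E}
    (hB : ∀ O ∈ 𝓝 (0 : E), ∀ᶠ s : ℝ in 𝓝 0, ∀ v ∈ B, s • v ∈ O)
    {𝒰 : Set (Set X)} (h𝒰 : ∀ U ∈ 𝒰, IsOpen U) (hcov : ⋃₀ 𝒰 = univ) :
    ∃ η : C(X, ℝ), ∀ x, 0 < η x ∧ η x ≤ 1 / 2 ∧ ∃ U ∈ 𝒰, x ∈ U ∧ ∀ s ∈ Icc 0 (η x), ∀ v ∈ B,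
      ∀ z : X, (z : E) = (1 - s) • (x : E) + s • x₀ + s • v → z ∈ U := by
  refine exists_continuous_forall_mem_convex_of_local_const
    (t := fun x : X => {η : ℝ | 0 < η ∧ η ≤ 1 / 2 ∧ ∃ U ∈ 𝒰, x ∈ U ∧ ∀ s ∈ Icc 0 η, ∀ v ∈ B,
      ∀ z : X, (z : E) = (1 - s) • (x : E) + s • x₀ + s • v → z ∈ U})
    (fun x => ?_) fun x => ?_
  · refine OrdConnected.convex ⟨?_⟩
    rintro a ⟨ha, -, -⟩ c ⟨-, hc, U, hU, hxU, h⟩ d ⟨had, hdc⟩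
    exact ⟨ha.trans_le had, hdc.trans hc, U, hU, hxU, fun s hs => h s ⟨hs.1, hs.2.trans hdc⟩⟩
  · obtain ⟨U, hU, hxU⟩ := mem_sUnion.1 (hcov.symm ▸ mem_univ x)
    obtain ⟨O, hO, rfl⟩ := isOpen_induced_iff.1 (h𝒰 U hU)
    obtain ⟨A, hA, δ, hδ, h⟩ := eventually_forall_mem_of_bounded hB (z := x)
      (Φ := fun p : X × ℝ × E => (1 - p.2.1) • (p.1 : E) + p.2.1 • x₀ + p.2.2)
      (by fun_prop) (hO.mem_nhds (by simpa using hxU))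
    refine ⟨min (δ / 2) (1 / 2), ?_⟩
    filter_upwards [hA, (hO.preimage continuous_subtype_val).mem_nhds hxU] with y hy hyU
    refine ⟨by positivity, min_le_right _ _, _, hU, hyU, fun s hs v hv z hz => ?_⟩
    have hsδ : |s| < δ := by
      rw [abs_of_nonneg hs.1]
      linarith [hs.2.trans (min_le_left _ _)]
    show (z : E) ∈ O
    rw [hz]
    exact h y hy s hsδ v hv

open BoundedContinuousFunction in
/-- Null sequences depending continuously on a parameter in the sup norm are small from some
(real) index on that depends continuously on the parameter. -/
theorem exists_continuous_index {Y : Type*} [MetricSpace Y] {F : Y → (ℕ →ᵇ ℝ)}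
    (hF : Continuous F) (hF0 : ∀ y, Tendsto (F y) atTop (𝓝 0)) (ε : C(Y, ℝ)) (hε : ∀ y, 0 < ε y)
    (n : ℕ) : ∃ θ : C(Y, ℝ), ∀ y, (n : ℝ) ≤ θ y ∧ ∀ m : ℕ, θ y < m + 1 → |F y m| < ε y := by
  refine exists_continuous_forall_mem_convex_of_local_const
    (t := fun y : Y => {θ : ℝ | (n : ℝ) ≤ θ ∧ ∀ m : ℕ, θ < m + 1 → |F y m| < ε y})
    (fun x => ?_) fun x => ?_
  · refine OrdConnected.convex ⟨?_⟩
    rintro a ⟨ha, h⟩ d - e ⟨hae, -⟩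
    exact ⟨ha.trans hae, fun m hm => h m (hae.trans_lt hm)⟩
  · obtain ⟨K, hK⟩ := Metric.tendsto_atTop.1 (hF0 x) _ (half_pos (hε x))
    have hcont : Continuous fun y => ε y - dist (F y) (F x) := by fun_prop
    refine ⟨max n (K + 1), ?_⟩
    have hxlt : ε x / 2 < ε x - dist (F x) (F x) := by
      rw [dist_self, sub_zero]
      exact half_lt_self (hε x)
    filter_upwards [hcont.continuousAt.eventually_const_lt hxlt] with y hy
    refine ⟨le_max_left _ _, fun m hm => ?_⟩
    have hKm : K ≤ m := by
      have : (K : ℝ) + 1 < m + 1 := (le_max_right _ _).trans_lt hm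
      exact_mod_cast (by linarith : (K : ℝ) ≤ m)
    have h1 := hK m hKm
    rw [Real.dist_eq, sub_zero] at h1
    have h2 := dist_coe_le_dist (f := F y) (g := F x) m
    rw [Real.dist_eq] at h2
    have h3 := abs_sub_abs_le_abs_sub (F y m) (F x m)
    linarith

/-- The core construction. Let `G` be the map to `c₀` obtained from `g`; it is continuous and
`G (x + v) = G x + g v` for `v` in the span of the sequence `b`. The map `f n` shrinks `X` slightly
towards `x₀`, to a point `sh x`, and then adds a small multiple of a point of the polygonal line
through the `b k` chosen so far out that the relevant coordinates of `G (sh x)` are negligible.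
Thus some coordinate `k ≥ n` of `G (f n x)` is bounded below, whereas near a given point `y` the
coordinates of `G` tend to zero uniformly. -/
theorem lfap_of_bounded_triangular {E : Type*} [AddCommGroup E] [Module ℝ E]
    [MetricSpace E] [IsTopologicalAddGroup E] [ContinuousSMul ℝ E]
    [LocallyConvexSpace ℝ E] {X : Set E} (hX : Convex ℝ X) {x₀ : E} {b : ℕ → E}
    (hb : ∀ k, x₀ + b k ∈ X)
    (hbd : ∀ O ∈ 𝓝 (0 : E), ∀ᶠ s : ℝ in 𝓝 0, ∀ k, s • b k ∈ O)
    {W : Set E} (hW : W ∈ 𝓝 0) (g : ℕ → StrongDual ℝ E) (hgW : ∀ k, ∀ w ∈ W, |g k w| ≤ 1)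
    (hg0 : ∀ k, ∀ j < k, g k (b j) = 0) (hg1 : ∀ k, g k (b k) = 1) : LFAP X := by
  intro 𝒰 h𝒰 hcov
  obtain ⟨β, hβ, hβb⟩ := exists_piecewise_affine b
  obtain ⟨Γ, hΓ, hΓg⟩ := exists_continuous_linearMap_bounded hW g hgW
  obtain ⟨r, hr, hrnull, hradd⟩ := exists_equivariant_map_nullSequences
  -- The polygonal line through the points `b k` is bounded.
  have hβbd : ∀ O ∈ 𝓝 (0 : E), ∀ᶠ s : ℝ in 𝓝 0, ∀ v ∈ β '' Ici 0, s • v ∈ O := by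
    intro O hO
    obtain ⟨V, ⟨hV, hVc⟩, hVO⟩ := (LocallyConvexSpace.convex_basis_zero ℝ E).mem_iff.1 hO
    filter_upwards [hbd V hV] with s hs
    rintro _ ⟨θ, hθ, rfl⟩
    obtain ⟨u, hu, h⟩ := hβb θ hθ
    refine hVO ?_
    rw [h, smul_add, smul_comm s, smul_comm s]
    exact hVc (hs _) (hs _) (by linarith [hu.2]) hu.1 (by ring)
  obtain ⟨η, hη⟩ := exists_continuous_displacement x₀ hβbd h𝒰 hcov
  have hηpos (x : X) : 0 < η x := (hη x).1
  have hηhalf (x : X) : η x ≤ 1 / 2 := (hη x).2.1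
  -- A bound for the entries above the diagonal of the matrix `g k (b j)`.
  obtain ⟨M, hM0, hM⟩ : ∃ M : ℝ, 0 ≤ M ∧ ∀ k j, |g k (b j)| ≤ M := by
    obtain ⟨s, hs, hs0⟩ := (((hbd W hW).filter_mono nhdsWithin_le_nhds).and
      (self_mem_nhdsWithin : Ioi (0 : ℝ) ∈ 𝓝[>] 0)).exists
    have hs0 : 0 < s := hs0
    refine ⟨1 / s, by positivity, fun k j => ?_⟩
    have := hgW k _ (hs j)
    rw [map_smul, smul_eq_mul, abs_mul, abs_of_pos hs0] at this
    rwa [le_div_iff₀ hs0, mul_comm]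
  let G : E → BoundedContinuousFunction ℕ ℝ := fun x => r (Γ x)
  have hG : Continuous G := hr.comp hΓ
  have hGnull (x : E) : Tendsto (G x) atTop (𝓝 0) := hrnull _
  have hbnull (j : ℕ) : Γ (b j) ∈ nullSequences := by
    refine tendsto_const_nhds.congr' ?_
    filter_upwards [eventually_gt_atTop j] with k hk
    rw [hΓg, hg0 k j hk]
  -- Equivariance of `G`, for displacements along an edge of the polygonal line.
  have hGadd (x : E) (s u v : ℝ) (i j k : ℕ) :
      G (x + s • (u • b i + v • b j)) k = G x k + s * (u * g k (b i) + v * g k (b j)) := by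
    have hmem : Γ (s • (u • b i + v • b j)) ∈ nullSequences := by
      simp only [map_smul, map_add]
      exact nullSequences.smul_mem _ (nullSequences.add_mem (nullSequences.smul_mem _ (hbnull i))
        (nullSequences.smul_mem _ (hbnull j)))
    simp only [G]
    rw [map_add, hradd _ _ hmem, BoundedContinuousFunction.add_apply, hΓg]
    simp only [map_smul, map_add, smul_eq_mul]
  -- A lower bound for the detected coordinate, relative to the displacement `η x`.
  let c : ℝ := 1 / (4 * (M + 1))
  have hc : 0 < c := by positivity
  let sh : X → E := fun x => (1 - η x) • (x : E) + η x • x₀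
  have hsh : Continuous sh := by fun_prop
  -- At `sh x` the coordinates of `G` with index greater than `θ n x - 1` are small.
  choose θ hθ using fun n => exists_continuous_index (hG.comp hsh) (fun x => hGnull (sh x))
    (ContinuousMap.const X c * η) (fun x => mul_pos hc (hηpos x)) n
  have hθ0 (n : ℕ) (x : X) : 0 ≤ θ n x := n.cast_nonneg.trans (hθ n x).1
  have hβmem (n : ℕ) (x : X) : β (θ n x) ∈ β '' Ici 0 := mem_image_of_mem β (hθ0 n x)
  let f (n : ℕ) (x : X) : E := sh x + η x • β (θ n x)
  have hf (n : ℕ) : Continuous (f n) := by fun_prop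
  have hfX (n : ℕ) (x : X) : f n x ∈ X := by
    obtain ⟨u, hu, h⟩ := hβb _ (hθ0 n x)
    have hmem := hX x.2 (hX (hb ⌊θ n x⌋₊) (hb (⌊θ n x⌋₊ + 1)) (sub_nonneg.2 hu.2) hu.1
      (sub_add_cancel 1 u)) (by linarith [hηhalf x]) (hηpos x).le (sub_add_cancel 1 (η x))
    convert hmem using 1
    simp only [f, sh, h]
    module
  have hdetect (n : ℕ) (x : X) : ∃ k ≥ n, c * η x ≤ |G (f n x) k| := by
    obtain ⟨u, hu, h⟩ := hβb _ (hθ0 n x)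
    set k := ⌊θ n x⌋₊
    have hnk : n ≤ k := Nat.le_floor (hθ n x).1
    have hlt : θ n x < k + 1 := Nat.lt_floor_add_one _
    have hηx := hηpos x
    have hcM : 4 * c * (M + 1) = 1 := by simp only [c]; field_simp
    -- If the weight `u` of `b (k + 1)` is at least `2 * c`, the coordinate `k + 1` detects it.
    -- Otherwise the coordinate `k` detects `b k`, as `u` is too small for the entry
    -- `g k (b (k + 1))`, whose sign is unknown, to cancel the contribution of `b k`.
    rcases le_total (2 * c) u with hcu | hcu
    · refine ⟨k + 1, by omega, ?_⟩
      have h1 : |G (sh x) (k + 1)| < c * η x := (hθ n x).2 (k + 1) (by push_cast; linarith)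
      have h2 : G (f n x) (k + 1) = G (sh x) (k + 1) + η x * u := by
        simp only [f, h, hGadd, hg1, hg0 (k + 1) k k.lt_succ_self]
        ring
      rw [h2]
      refine le_trans ?_ (le_abs_self _)
      nlinarith [abs_lt.1 h1]
    · refine ⟨k, hnk, ?_⟩
      have h1 : |G (sh x) k| < c * η x := (hθ n x).2 k hlt
      have h2 : G (f n x) k = G (sh x) k + η x * (1 - u + u * g k (b (k + 1))) := by
        simp only [f, h, hGadd, hg1]
        ring
      have h3 : -(u * M) ≤ u * g k (b (k + 1)) := by
        nlinarith [abs_le.1 (hM k (k + 1)), hu.1]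
      have h4 : 2 * c ≤ 1 - u + u * g k (b (k + 1)) := by
        have : u * (M + 1) ≤ 1 / 2 := by nlinarith
        nlinarith
      rw [h2]
      refine le_trans ?_ (le_abs_self _)
      nlinarith [abs_lt.1 h1]
  refine ⟨fun n x => ⟨f n x, hfX n x⟩, fun n => (hf n).subtype_mk _, fun n x => ?_, fun y => ?_⟩
  · obtain ⟨-, -, U, hU, hxU, h⟩ := hη x
    exact ⟨U, hU, h (η x) ⟨(hηpos x).le, le_rfl⟩ _ (hβmem n x) _ rfl, hxU⟩
  -- If `f n x` is near `y` then `η x` is not small: otherwise `x` itself would be near `y`.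
  have hηlow : ∃ N ∈ 𝓝 (y : E), ∃ e > 0, ∀ n x, f n x ∈ N → e ≤ η x := by
    have hmem : {x : X | η y / 2 < η x} ∈ 𝓝 y :=
      η.continuous.continuousAt.eventually_const_lt (half_lt_self (hηpos y))
    obtain ⟨O, hO, hOη⟩ := mem_nhds_induced (Subtype.val) y _ |>.1 hmem
    obtain ⟨N, hN, δ, hδ, h⟩ := eventually_forall_mem_of_bounded hβbd (z := (y : E))
      (Φ := fun p : E × ℝ × E => (1 - p.2.1)⁻¹ • (p.1 - p.2.1 • x₀ - p.2.2))
      (by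
        have : (1 - (0 : ℝ)) ≠ 0 := by norm_num
        fun_prop (disch := assumption)) (by simpa using hO)
    refine ⟨N, hN, min δ (η y / 2), lt_min hδ (half_pos (hηpos y)), fun n x hx => ?_⟩
    by_contra! hlt
    have hxO := h _ hx (η x) (by
      rw [abs_of_pos (hηpos x)]
      exact hlt.trans_le (min_le_left _ _)) _ (hβmem n x)
    have hne : 1 - η x ≠ 0 := by linarith [hηhalf x]
    have hx' : (1 - η x)⁻¹ • (f n x - η x • x₀ - η x • β (θ n x)) = (x : E) := by
      rw [inv_smul_eq_iff₀ hne]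
      simp only [f, sh]
      abel
    dsimp only at hxO
    rw [hx'] at hxO
    have := hOη hxO
    exact absurd (hlt.trans_le (min_le_right _ _)) (not_lt.2 (le_of_lt this))
  obtain ⟨N, hN, e, he, hNe⟩ := hηlow
  have hce : 0 < c * e := mul_pos hc he
  obtain ⟨K, hK⟩ := Metric.tendsto_atTop.1 (hGnull y) _ (half_pos hce)
  have hball : {z : E | dist (G z) (G y) < c * e / 2} ∈ 𝓝 (y : E) :=
    hG.continuousAt.eventually_mem (Metric.ball_mem_nhds _ (half_pos hce))
  refine ⟨Subtype.val ⁻¹' (N ∩ {z : E | dist (G z) (G y) < c * e / 2}),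
    continuous_subtype_val.continuousAt.preimage_mem_nhds (inter_mem hN hball),
    (finite_Iio K).subset ?_⟩
  rintro n ⟨_, ⟨x, rfl⟩, hxN, hxG⟩
  by_contra hn
  obtain ⟨k, hk, hGk⟩ := hdetect n x
  have h1 := hK k ((not_lt.1 hn).trans hk)
  rw [Real.dist_eq, sub_zero] at h1
  have h2 := BoundedContinuousFunction.dist_coe_le_dist (f := G (f n x)) (g := G y) k
  rw [Real.dist_eq] at h2
  have h3 := abs_sub_abs_le_abs_sub (G (f n x) k) (G y k)
  have h4 : c * e ≤ c * η x := by gcongr; exact hNe n x hxN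
  have h5 : dist (G (f n x)) (G y) < c * e / 2 := hxG
  linarith

end Construction

theorem theorem5 {E : Type*} [AddCommGroup E] [Module ℝ E] [MetricSpace E]
    [IsTopologicalAddGroup E] [ContinuousSMul ℝ E] [LocallyConvexSpace ℝ E] [CompleteSpace E]
    (hinv : ∀ x y z : E, dist (x + z) (y + z) = dist x y)
    (X : Set E) (hconv : Convex ℝ X) (hsep : ¬ TopologicalSpace.SeparableSpace X) :
    LFAP X := by
  obtain ⟨U, hU, hXU⟩ := exists_not_countablyCovered_of_not_separableSpace hinv hsep
  have hne : X.Nonempty := by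
    by_contra h
    exact hXU ⟨∅, countable_empty, fun x hx => (h ⟨x, hx⟩).elim⟩
  obtain ⟨x₀, -⟩ := hne
  have hS : ¬ CountablyCovered U {v | x₀ + v ∈ X} := fun ⟨D, hD, h⟩ =>
    hXU ⟨(x₀ + ·) '' D, hD.image _, fun x hx => by
      obtain ⟨d, hd, hxd⟩ := h (x - x₀) (by simpa using hx)
      exact ⟨x₀ + d, mem_image_of_mem _ hd, by simpa [sub_sub] using hxd⟩⟩
  have hadd : ∀ᶠ p : E × E in 𝓝 0 ×ˢ 𝓝 0, p.1 + p.2 ∈ U := by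
    rw [← nhds_prod_eq]
    exact continuous_add.continuousAt.eventually_mem (by simpa using hU)
  obtain ⟨V, hV, hVU⟩ := (eventually_prod_self_iff (r := fun v w => v + w ∈ U)).1 hadd
  obtain ⟨W, ⟨hW0, hWo, hWb, hWc⟩, hWV⟩ := (nhds_hasBasis_absConvex_open ℝ E).mem_iff.1 hV
  have hW : W ∈ 𝓝 (0 : E) := hWo.mem_nhds hW0
  obtain ⟨b, hbS, hbd, hbW⟩ := exists_bounded_seq_far_from_span hS hW
    fun v hv w hw => hVU v (hWV hv) w (hWV hw)
  choose g hg0 hg1 hgW using fun k => exists_dual_vanishing_eq_one hWc hWo hW0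
    (fun w hw => hWb.neg_mem_iff.2 hw) (Submodule.span ℝ (b '' Iio k)) (hbW k)
  exact lfap_of_bounded_triangular hconv hbS hbd hW g hgW
    (fun k j hj => hg0 k _ (Submodule.subset_span (mem_image_of_mem _ hj))) hg1
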